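/- Let $G$ be a finite simple graph on $n$ vertices, where $n$ is even, with minimum degree $\delta(G)\ge 3n/4$, and let every edge of $G$ be colored either red or blue. A red (respectively blue) connected matching is a possibly empty set of pairwise vertex-disjoint red (respectively blue) edges of $G$ that all lie in one connected component of the graph formed by all red (respectively blue) edges of $G$. Then there exist a red connected matching and a blue connected matching that have no vertex in common and whose union is a perfect matching of $G$. -/

import Mathlib

/-- The two colors of a red/blue edge coloring. -/
inductive EdgeColor : Type
  | red
  | blue

/-- `M` is a connected matching of color `k` in the edge-colored graph `G`: it is a matching
of `G`, all its edges have color `k`, and any two vertices that it covers (hence all its edges)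
lie in the same connected component of the graph formed by all edges of color `k`.
The empty matching is allowed. -/
def IsConnectedMatching {V : Type*} {G : SimpleGraph V} (C : G.EdgeLabeling EdgeColor)
    (k : EdgeColor) (M : G.Subgraph) : Prop :=
  M.IsMatching ∧
  (∀ u v : V, M.Adj u v → (C.labelGraph k).Adj u v) ∧
  (∀ u ∈ M.verts, ∀ v ∈ M.verts, (C.labelGraph k).Reachable u v)

/-!
Two monochromatic connected matchings of different colours that partition the vertices are the
same thing as a perfect matching of a graph `twoComponentGraph P Q r b`: the red edges in one red
component (that of `r`) together with the blue edges in one blue component (that of `b`). The task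
is to choose `r` and `b` so that Tutte's condition holds.

The choice rests on one criterion, `exists_isPerfectMatching_of_largest_class`. Label the vertices,
and let `a` be a label used at least as often as any other. Suppose that the graph `H` contains the
edges of `G` between different labels and those inside the class of `a`. Then `H` has a perfect
matching. Otherwise, by Tutte's theorem and parity, deleting some set `S` leaves at least `|S| + 2`
components; let `v`, with label `j`, lie in a smallest one. Vertices in different components are
non-adjacent in `G` unless they share a label other than `a`, while non-neighbourhoods have fewer
than `n / 4` vertices. Hence `j ≠ a`, and every component meets the class of `j`, so that this
class, and with it the class of `a`, has more than `|S|` vertices. Therefore some `w ∉ S` has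
label `a`, so all components other than that of `w` together have fewer than `n / 4` vertices. The
component of `v` is then so small that the class of `j` has more than `n / 2` vertices, so it is
larger than that of `a`, a contradiction.

There are two situations (`exists_twoComponentGraph_isPerfectMatching`). If one of the colours is
connected, the criterion is applied with the components of the other colour as labels. Otherwise
some `u` and `v` are joined in neither colour, so each of their at least `n / 2` common
neighbours belongs either to the red component of `u` and the blue component of `v`, or vice versa.
If both kinds occur, then `G` is covered by four sets, each contained in a non-neighbourhood, which
is too few vertices. So a set of at least `n / 2` vertices lies in the intersection of a red and a
blue component, and the criterion applies to that intersection and its complement.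
-/

/-! ### A matching criterion from Tutte's theorem -/

open Finset in
/-- The counting behind the matching criterion: under its hypotheses, with `comp` a labelling
constant on the components of `H` outside `S`, at most `|S| + 1` components can be left. -/
lemma card_image_lt_of_largest_class {V ι κ : Type*} [Fintype V] [DecidableEq V] [DecidableEq ι]
    [DecidableEq κ] {G H : SimpleGraph V}
    (hG : ∀ v, ∀ A : Finset V, v ∉ A → (∀ u ∈ A, ¬ G.Adj v u) → 4 * #A + 4 ≤ Fintype.card V)
    (f : V → ι) (a : ι) (hmax : ∀ j, #{v | f v = j} ≤ #{v | f v = a})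
    (hne : ∀ u v, G.Adj u v → f u ≠ f v → H.Adj u v)
    (ha : ∀ u v, G.Adj u v → f u = a → f v = a → H.Adj u v)
    (S : Finset V) (comp : V → κ)
    (hcomp : ∀ u v, u ∉ S → v ∉ S → H.Adj u v → comp u = comp v) :
    #((Sᶜ).image comp) < #S + 2 := by
  by_contra! hq
  have hW : #(Sᶜ) = Fintype.card V - #S := card_compl S
  have hSn : #S ≤ Fintype.card V := card_le_univ S
  have hqW : #((Sᶜ).image comp) ≤ #(Sᶜ) := card_image_le
  have hQ : ((Sᶜ).image comp).Nonempty := card_pos.mp (by omega)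
  obtain ⟨k₁, hk₁, hmin⟩ := exists_min_image _ (fun k => #{x ∈ Sᶜ | comp x = k}) hQ
  set c := #{x ∈ Sᶜ | comp x = k₁} with hc
  have hcq : c * (#S + 2) ≤ #(Sᶜ) :=
    (Nat.mul_le_mul_left _ hq).trans (mul_card_image_le_card _ _ hmin)
  have hc2 : 2 * c ≤ #(Sᶜ) := by nlinarith
  obtain ⟨v, hvW, hvk⟩ := mem_image.mp hk₁
  have hvS : v ∉ S := mem_compl.mp hvW
  -- A vertex labelled `a` is non-adjacent in `G` to everything outside its component and `S`.
  have hA : ∀ w ∉ S, f w = a → 4 * #{x ∈ Sᶜ | comp x ≠ comp w} + 4 ≤ Fintype.card V := by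
    intro w hw hwa
    refine hG w _ (by simp) fun u hu hadj => ?_
    simp only [mem_filter, mem_compl] at hu
    refine hu.2 (hcomp w u hw hu.1 ?_).symm
    by_cases h : f w = f u
    · exact ha _ _ hadj hwa (h ▸ hwa)
    · exact hne _ _ hadj h
  have hA₁ : ∀ w ∉ S, f w = a → comp w ≠ k₁ := by
    intro w hw hwa hwk
    have h1 := hA w hw hwa
    have h2 := card_filter_add_card_filter_not (s := Sᶜ) (fun x => comp x = k₁)
    rw [hwk] at h1
    simp only [ne_eq] at h1
    omega
  have hva : f v ≠ a := fun h => hA₁ v hvS h hvk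
  have hAv : 4 * #{x ∈ Sᶜ | comp x ≠ k₁ ∧ f x ≠ f v} + 4 ≤ Fintype.card V := by
    refine hG v _ (by simp) fun u hu hadj => ?_
    simp only [mem_filter, mem_compl] at hu
    exact hu.2.1 (hvk ▸ (hcomp v u hvS hu.1 (hne _ _ hadj hu.2.2.symm)).symm)
  have hcover : #(Sᶜ) ≤ c + #{x ∈ Sᶜ | comp x ≠ k₁ ∧ f x ≠ f v} + #{x ∈ Sᶜ | f x = f v} := by
    refine (card_le_card (t := ({x ∈ Sᶜ | comp x = k₁} ∪
      {x ∈ Sᶜ | comp x ≠ k₁ ∧ f x ≠ f v}) ∪ {x ∈ Sᶜ | f x = f v}) ?_).trans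
      ((card_union_le _ _).trans (Nat.add_le_add_right (card_union_le _ _) _))
    intro x hx
    simp only [mem_union, mem_filter]
    tauto
  -- Every component meets the class of `v`.
  have hmeet : (Sᶜ).image comp ⊆ ({x ∈ Sᶜ | f x = f v} : Finset V).image comp := by
    intro k hk
    obtain ⟨u, hu, rfl⟩ := mem_image.mp hk
    by_contra hno
    have hno' : ∀ x ∉ S, f x = f v → comp x ≠ comp u := by
      intro x hx hxv hxu
      exact hno (mem_image.mpr ⟨x, by simp [hx, hxv], hxu⟩)
    have huS : u ∉ S := mem_compl.mp hu
    have hfu : f u ≠ f v := fun h => hno' u huS h rfl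
    have hAu : 4 * #{x ∈ Sᶜ | f x = f v} + 4 ≤ Fintype.card V := by
      refine hG u _ (by simp [hfu]) fun x hx hadj => ?_
      simp only [mem_filter, mem_compl] at hx
      exact hno' x hx.1 hx.2 (hcomp u x huS hx.1 (hne _ _ hadj (hx.2 ▸ hfu))).symm
    have h1 : Fintype.card V + 4 ≤ 2 * c + 2 * #S := by omega
    have h2 : #(Sᶜ) + #S = Fintype.card V := by omega
    nlinarith
  have hqj := (card_le_card hmeet).trans card_image_le
  have hj : #{x ∈ Sᶜ | f x = f v} ≤ #{x | f x = f v} :=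
    card_le_card (filter_subset_filter _ (subset_univ _))
  have hja := hmax (f v)
  obtain ⟨w, hwa, hwS⟩ : ∃ w, f w = a ∧ w ∉ S := by
    by_contra! hno
    have : #{x | f x = a} ≤ #S := card_le_card fun x hx => hno x (by simpa using hx)
    omega
  have hAw := hA w hwS hwa
  -- Outside the component of `w` there are the component of `v` and at least `|S|` others.
  have hrest : c + #S ≤ #{x ∈ Sᶜ | comp x ≠ comp w} := by
    have hk := hA₁ w hwS hwa
    have h1 : (((Sᶜ).image comp).erase k₁).erase (comp w) ⊆
        ({x ∈ Sᶜ | comp x ≠ comp w ∧ comp x ≠ k₁} : Finset V).image comp := by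
      intro k hk
      simp only [mem_erase] at hk
      obtain ⟨x, hx, rfl⟩ := mem_image.mp hk.2.2
      exact mem_image.mpr ⟨x, by simp only [mem_filter]; tauto, rfl⟩
    have h2 := (card_le_card h1).trans card_image_le
    have h3 := pred_card_le_card_erase (s := ((Sᶜ).image comp).erase k₁) (a := comp w)
    have h4 := card_erase_of_mem hk₁
    have h5 := card_filter_add_card_filter_not (s := ({x ∈ Sᶜ | comp x ≠ comp w} : Finset V))
      (fun x => comp x = k₁)
    rw [filter_filter, filter_filter] at h5
    have h6 : ({x ∈ Sᶜ | comp x ≠ comp w ∧ comp x = k₁} : Finset V) = {x ∈ Sᶜ | comp x = k₁} := by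
      refine filter_congr fun x _ => ⟨fun h => h.2, fun h => ⟨?_, h⟩⟩
      rw [h]
      exact hk.symm
    rw [h6] at h5
    simp only [ne_eq] at h2 h5 ⊢
    omega
  have hdisj : #{x | f x = f v} + #{x | f x = a} ≤ Fintype.card V := by
    rw [← card_union_of_disjoint]
    · exact card_le_univ _
    · exact disjoint_filter.mpr fun x _ h1 h2 => hva (h1.symm.trans h2)
  omega

open Finset in
/-- A graph of even order has a perfect matching if it retains, from a graph in which every vertex
has fewer than a quarter of all vertices as non-neighbours, the edges between different labels and
the edges inside a largest label class. -/
lemma exists_isPerfectMatching_of_largest_class {V ι : Type*} [Fintype V] [DecidableEq ι]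
    {G H : SimpleGraph V} (heven : Even (Fintype.card V))
    (hG : ∀ v, ∀ A : Finset V, v ∉ A → (∀ u ∈ A, ¬ G.Adj v u) → 4 * #A + 4 ≤ Fintype.card V)
    (f : V → ι) (a : ι) (hmax : ∀ j, #{v | f v = j} ≤ #{v | f v = a})
    (hne : ∀ u v, G.Adj u v → f u ≠ f v → H.Adj u v)
    (ha : ∀ u v, G.Adj u v → f u = a → f v = a → H.Adj u v) :
    ∃ M : H.Subgraph, M.IsPerfectMatching := by
  classical
  rw [SimpleGraph.tutte]
  intro U hU
  rw [SimpleGraph.IsTutteViolator] at hU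
  set K := ((⊤ : H.Subgraph).deleteVerts U).coe with hK
  let comp : V → Option K.ConnectedComponent := fun v =>
    if h : v ∈ U then none else some (K.connectedComponentMk ⟨v, by simpa using h⟩)
  have hlt := card_image_lt_of_largest_class hG f a hmax hne ha U.toFinset comp (by
    intro u v hu hv hadj
    rw [Set.mem_toFinset] at hu hv
    simp only [comp, hu, hv, dite_false, Option.some.injEq, SimpleGraph.ConnectedComponent.eq]
    apply SimpleGraph.Adj.reachable
    simp [hK, hu, hv, hadj])
  have hsub : K.oddComponents.ncard ≤ #((U.toFinsetᶜ).image comp) := by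
    rw [← Set.ncard_coe_finset, ← Set.ncard_image_of_injective _ (Option.some_injective _)]
    refine Set.ncard_le_ncard ?_ (Set.toFinite _)
    rintro _ ⟨k, -, rfl⟩
    induction k using SimpleGraph.ConnectedComponent.ind with
    | h v =>
      have hv : v.1 ∉ U := by simpa using v.2
      simp only [coe_image, Set.mem_image, mem_coe, mem_compl, Set.mem_toFinset]
      exact ⟨v.1, hv, by simp [comp, hv]⟩
  -- The number of odd components has the parity of `n - |U|`, so it exceeds `|U|` by at least two.
  have hodd := K.odd_ncard_oddComponents
  have hcard : Nat.card ((⊤ : H.Subgraph).deleteVerts U).verts = Fintype.card V - U.ncard := by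
    rw [SimpleGraph.Subgraph.deleteVerts_verts, SimpleGraph.Subgraph.verts_top,
      ← Set.compl_eq_univ_sdiff, Nat.card_coe_set_eq, Set.ncard_compl, Nat.card_eq_fintype_card]
  have hUle : U.ncard ≤ Fintype.card V := by
    rw [← Nat.card_eq_fintype_card]
    exact Set.ncard_le_card U
  rw [hcard] at hodd
  rw [← Set.ncard_eq_toFinset_card'] at hlt
  have hq : K.oddComponents.ncard = U.ncard + 1 := by omega
  rw [hq] at hodd
  grind

/-! ### Choosing one component of each colour -/

/-- The edges of `P` in the component of `r` together with the edges of `Q` in the component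
of `b`. -/
def twoComponentGraph {V : Type*} (P Q : SimpleGraph V) (r b : V) : SimpleGraph V where
  Adj u v := (P.Adj u v ∧ P.Reachable r u) ∨ (Q.Adj u v ∧ Q.Reachable b u)
  symm := ⟨by
    rintro u v (⟨h, hr⟩ | ⟨h, hb⟩)
    · exact Or.inl ⟨h.symm, hr.trans h.reachable⟩
    · exact Or.inr ⟨h.symm, hb.trans h.reachable⟩⟩
  loopless := ⟨by simp⟩

lemma twoComponentGraph_swap {V : Type*} (P Q : SimpleGraph V) (r b : V) :
    twoComponentGraph P Q r b = twoComponentGraph Q P b r := by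
  ext u v
  exact or_comm

lemma preconnected_or_preconnected_of_reachable {V : Type*} {P Q : SimpleGraph V}
    (h : ∀ u v, P.Reachable u v ∨ Q.Reachable u v) : P.Preconnected ∨ Q.Preconnected := by
  by_contra! hcon
  obtain ⟨hP, hQ⟩ := hcon
  simp only [SimpleGraph.Preconnected, not_forall] at hP
  obtain ⟨u, v, huv⟩ := hP
  refine hQ ?_
  have huv' : Q.Reachable u v := (h u v).resolve_left huv
  have key : ∀ w, Q.Reachable u w := by
    intro w
    rcases h u w with h1 | h1
    · rcases h v w with h2 | h2
      · exact absurd (h1.trans h2.symm) huv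
      · exact huv'.trans h2
    · exact h1
  exact fun x y => (key x).symm.trans (key y)

section TwoGraphs

variable {V : Type*} [Fintype V] {G P Q : SimpleGraph V}

open Finset in
lemma exists_twoComponentGraph_isPerfectMatching_of_preconnected [Nonempty V]
    (heven : Even (Fintype.card V))
    (hG : ∀ v, ∀ A : Finset V, v ∉ A → (∀ u ∈ A, ¬ G.Adj v u) → 4 * #A + 4 ≤ Fintype.card V)
    (hPQ : ∀ u v, G.Adj u v → P.Adj u v ∨ Q.Adj u v) (hP : P.Preconnected) :
    ∃ r b, ∃ M : (twoComponentGraph P Q r b).Subgraph, M.IsPerfectMatching := by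
  classical
  obtain ⟨a, -, hmax⟩ := exists_max_image (univ : Finset Q.ConnectedComponent)
    (fun j => #{v | Q.connectedComponentMk v = j}) ⟨Q.connectedComponentMk (Classical.arbitrary V),
      mem_univ _⟩
  induction a using SimpleGraph.ConnectedComponent.ind with
  | h b =>
    refine ⟨b, b, exists_isPerfectMatching_of_largest_class heven hG Q.connectedComponentMk
      (Q.connectedComponentMk b) (fun j => hmax j (mem_univ j)) ?_ ?_⟩
    · intro u v hadj hne
      rcases hPQ u v hadj with h | h
      · exact Or.inl ⟨h, hP b u⟩
      · exact absurd (SimpleGraph.ConnectedComponent.eq.mpr h.reachable) hne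
    · intro u v hadj hu _
      rcases hPQ u v hadj with h | h
      · exact Or.inl ⟨h, hP b u⟩
      · exact Or.inr ⟨h, (SimpleGraph.ConnectedComponent.eq.mp hu).symm⟩

open Finset in
/-- If at least half of all vertices lie in the intersection of a component of `P` and a component
of `Q`, then these two components carry a perfect matching. -/
lemma twoComponentGraph_isPerfectMatching_of_half
    (heven : Even (Fintype.card V))
    (hG : ∀ v, ∀ A : Finset V, v ∉ A → (∀ u ∈ A, ¬ G.Adj v u) → 4 * #A + 4 ≤ Fintype.card V)
    (hPQ : ∀ u v, G.Adj u v → P.Adj u v ∨ Q.Adj u v) {r b : V} (D : Finset V)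
    (hD : ∀ w ∈ D, P.Reachable r w ∧ Q.Reachable b w) (hhalf : Fintype.card V ≤ 2 * #D) :
    ∃ M : (twoComponentGraph P Q r b).Subgraph, M.IsPerfectMatching := by
  classical
  have hadj : ∀ u v, G.Adj u v → u ∈ D → (twoComponentGraph P Q r b).Adj u v := by
    intro u v h hu
    exact (hPQ u v h).imp (fun h' => ⟨h', (hD u hu).1⟩) (fun h' => ⟨h', (hD u hu).2⟩)
  refine exists_isPerfectMatching_of_largest_class heven hG (fun v => decide (v ∈ D)) true ?_ ?_ ?_
  · have h := card_compl D
    rintro (_ | _)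
    · simp only [decide_eq_false_iff_not, decide_eq_true_eq, filter_univ_mem]
      rw [filter_not, filter_univ_mem, ← compl_eq_univ_sdiff]
      omega
    · rfl
  · intro u v h hne
    by_cases hu : u ∈ D
    · exact hadj u v h hu
    · have hv : v ∈ D := by by_contra hv; simp [hu, hv] at hne
      exact (hadj v u h.symm hv).symm
  · intro u v h hu _
    exact hadj u v h (by simpa using hu)

open Finset in
/-- Two vertices joined neither by `P` nor by `Q` have many common neighbours, and each of these
reaches one of the two through `P` and the other through `Q`. -/
lemma card_le_of_not_reachable
    (hG : ∀ v, ∀ A : Finset V, v ∉ A → (∀ u ∈ A, ¬ G.Adj v u) → 4 * #A + 4 ≤ Fintype.card V)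
    (hPQ : ∀ u v, G.Adj u v → P.Adj u v ∨ Q.Adj u v) {u v : V}
    (hP : ¬ P.Reachable u v) (hQ : ¬ Q.Reachable u v) (A B : Finset V)
    (hA : ∀ w, P.Reachable u w → Q.Reachable v w → w ∈ A)
    (hB : ∀ w, P.Reachable v w → Q.Reachable u w → w ∈ B) :
    Fintype.card V ≤ 2 * (#A + #B) := by
  classical
  have hu := hG u (({w | ¬ G.Adj u w} : Finset V) \ {u}) (by simp) (by simp +contextual)
  have hv := hG v (({w | ¬ G.Adj v w} : Finset V) \ {v}) (by simp) (by simp +contextual)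
  have hu' := le_card_sdiff {u} ({w | ¬ G.Adj u w} : Finset V)
  have hv' := le_card_sdiff {v} ({w | ¬ G.Adj v w} : Finset V)
  rw [card_singleton] at hu' hv'
  have hcov : (univ : Finset V) ⊆
      (({w | ¬ G.Adj u w} : Finset V) ∪ ({w | ¬ G.Adj v w} : Finset V)) ∪ (A ∪ B) := by
    intro w _
    simp only [mem_union, mem_filter, mem_univ, true_and]
    by_cases h1 : G.Adj u w
    · by_cases h2 : G.Adj v w
      · right
        rcases hPQ u w h1 with h1 | h1 <;> rcases hPQ v w h2 with h2 | h2
        · exact absurd (h1.reachable.trans h2.reachable.symm) hP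
        · exact Or.inl (hA w h1.reachable h2.reachable)
        · exact Or.inr (hB w h2.reachable h1.reachable)
        · exact absurd (h1.reachable.trans h2.reachable.symm) hQ
      · exact Or.inl (Or.inr h2)
    · exact Or.inl (Or.inl h1)
  have h1 := card_le_card hcov
  have h2 := card_union_le (({w | ¬ G.Adj u w} : Finset V) ∪ ({w | ¬ G.Adj v w} : Finset V)) (A ∪ B)
  have h3 := card_union_le ({w | ¬ G.Adj u w} : Finset V) ({w | ¬ G.Adj v w} : Finset V)
  have h4 := card_union_le A B
  rw [card_univ] at h1
  omega

open Finset in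
lemma exists_twoComponentGraph_isPerfectMatching [Nonempty V]
    (heven : Even (Fintype.card V))
    (hG : ∀ v, ∀ A : Finset V, v ∉ A → (∀ u ∈ A, ¬ G.Adj v u) → 4 * #A + 4 ≤ Fintype.card V)
    (hPQ : ∀ u v, G.Adj u v → P.Adj u v ∨ Q.Adj u v) :
    ∃ r b, ∃ M : (twoComponentGraph P Q r b).Subgraph, M.IsPerfectMatching := by
  classical
  by_cases hall : ∀ u v, P.Reachable u v ∨ Q.Reachable u v
  · rcases preconnected_or_preconnected_of_reachable hall with hP | hQ
    · exact exists_twoComponentGraph_isPerfectMatching_of_preconnected heven hG hPQ hP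
    · obtain ⟨b, r, hM⟩ := exists_twoComponentGraph_isPerfectMatching_of_preconnected heven hG
        (fun u v h => (hPQ u v h).symm) hQ
      exact ⟨r, b, by rwa [twoComponentGraph_swap]⟩
  push Not at hall
  obtain ⟨u, v, hP, hQ⟩ := hall
  -- Vertices joined neither by `P` nor by `Q` are not adjacent in `G`.
  have hsep : ∀ x, ∀ X : Finset V, (∀ y ∈ X, ¬ P.Reachable x y ∧ ¬ Q.Reachable x y) →
      4 * #X + 4 ≤ Fintype.card V := fun x X hX =>
    hG x X (fun hx => (hX x hx).1 .rfl) fun y hy h =>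
      (hPQ x y h).elim (fun h' => (hX y hy).1 h'.reachable) (fun h' => (hX y hy).2 h'.reachable)
  let A : Finset V := {w | P.Reachable u w ∧ Q.Reachable v w}
  let B : Finset V := {w | P.Reachable v w ∧ Q.Reachable u w}
  have hA : ∀ w ∈ A, P.Reachable u w ∧ Q.Reachable v w := fun w hw => by simpa [A] using hw
  have hB : ∀ w ∈ B, P.Reachable v w ∧ Q.Reachable u w := fun w hw => by simpa [B] using hw
  have hAB := card_le_of_not_reachable hG hPQ hP hQ A B (fun w h1 h2 => by simp [A, h1, h2])
    (fun w h1 h2 => by simp [B, h1, h2])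
  rcases A.eq_empty_or_nonempty with hA0 | ⟨p, hp⟩
  · rw [hA0, card_empty, zero_add] at hAB
    exact ⟨v, u, twoComponentGraph_isPerfectMatching_of_half heven hG hPQ B hB hAB⟩
  rcases B.eq_empty_or_nonempty with hB0 | ⟨q, hq⟩
  · rw [hB0, card_empty, add_zero] at hAB
    exact ⟨u, v, twoComponentGraph_isPerfectMatching_of_half heven hG hPQ A hA hAB⟩
  -- Both kinds of common neighbours occur: all four intersections of components are small.
  exfalso
  obtain ⟨hp1, hp2⟩ := hA p hp
  obtain ⟨hq1, hq2⟩ := hB q hq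
  let C : Finset V := {w | P.Reachable u w ∧ Q.Reachable u w}
  let D : Finset V := {w | P.Reachable v w ∧ Q.Reachable v w}
  have hCD := card_le_of_not_reachable hG hPQ (u := p) (v := q)
    (fun h => hP ((hp1.trans h).trans hq1.symm)) (fun h => hQ ((hp2.trans h).trans hq2.symm).symm)
    C D (fun w h1 h2 => by simp [C, hp1.trans h1, hq2.trans h2])
    (fun w h1 h2 => by simp [D, hq1.trans h1, hp2.trans h2])
  have h1 := hsep p B fun y hy => ⟨fun h => hP ((hp1.trans h).trans (hB y hy).1.symm),
    fun h => hQ ((hp2.trans h).trans (hB y hy).2.symm).symm⟩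
  have h2 := hsep q A fun y hy => ⟨fun h => hP ((hq1.trans h).trans (hA y hy).1.symm).symm,
    fun h => hQ ((hq2.trans h).trans (hA y hy).2.symm)⟩
  have h3 := hsep u D fun y hy => by
    have hy' : P.Reachable v y ∧ Q.Reachable v y := by simpa [D] using hy
    exact ⟨fun h => hP (h.trans hy'.1.symm), fun h => hQ (h.trans hy'.2.symm)⟩
  have h4 := hsep v C fun y hy => by
    have hy' : P.Reachable u y ∧ Q.Reachable u y := by simpa [C] using hy
    exact ⟨fun h => hP (h.trans hy'.1.symm).symm, fun h => hQ (h.trans hy'.2.symm).symm⟩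
  omega

end TwoGraphs

/-! ### Splitting a perfect matching by colour -/

/-- The edges of `M` that have colour `k`, with the vertices they cover, as a subgraph of `G`. -/
def colorPart {V : Type*} {G H : SimpleGraph V} (C : G.EdgeLabeling EdgeColor) (M : H.Subgraph)
    (k : EdgeColor) : G.Subgraph where
  verts := {v | ∃ w, M.Adj v w ∧ (C.labelGraph k).Adj v w}
  Adj v w := M.Adj v w ∧ (C.labelGraph k).Adj v w
  adj_sub h := C.labelGraph_le h.2
  edge_vert h := ⟨_, h⟩
  symm := ⟨fun _ _ h => ⟨h.1.symm, h.2.symm⟩⟩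

lemma isConnectedMatching_colorPart {V : Type*} {G H : SimpleGraph V}
    (C : G.EdgeLabeling EdgeColor) {M : H.Subgraph} (hM : M.IsMatching) (k : EdgeColor) (r : V)
    (hr : ∀ u v, M.Adj u v → (C.labelGraph k).Adj u v → (C.labelGraph k).Reachable r u) :
    IsConnectedMatching C k (colorPart C M k) := by
  refine ⟨?_, fun u v h => h.2, ?_⟩
  · rintro v ⟨w, h⟩
    exact ⟨w, h, fun y hy => hM.eq_of_adj_left hy.1 h.1⟩
  · rintro u ⟨u', hu⟩ v ⟨v', hv⟩
    exact (hr u u' hu.1 hu.2).symm.trans (hr v v' hv.1 hv.2)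

open Finset in
/-- Minimum degree at least `3n/4`, restated as a bound on non-neighbourhoods. -/
lemma four_mul_card_add_four_le_of_not_adj {V : Type*} [Fintype V] {G : SimpleGraph V}
    [DecidableRel G.Adj] (hdeg : 3 * Fintype.card V ≤ 4 * G.minDegree) (v : V) (A : Finset V)
    (hv : v ∉ A) (hA : ∀ u ∈ A, ¬ G.Adj v u) : 4 * #A + 4 ≤ Fintype.card V := by
  classical
  have h1 := G.minDegree_le_degree v
  have h2 : #(insert v A ∪ G.neighborFinset v) ≤ Fintype.card V := card_le_univ _
  rw [card_union_of_disjoint, card_insert_of_notMem hv, G.card_neighborFinset_eq_degree] at h2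
  · omega
  · rw [disjoint_left]
    intro x hx hx'
    rw [SimpleGraph.mem_neighborFinset] at hx'
    rcases mem_insert.mp hx with rfl | hx
    · exact G.irrefl hx'
    · exact hA x hx hx'

theorem mainTheorem6 {V : Type*} [Fintype V] (G : SimpleGraph V) [DecidableRel G.Adj]
    (n : ℕ) (hn : Fintype.card V = n) (heven : Even n)
    (hdeg : (3 * (n : ℝ)) / 4 ≤ (G.minDegree : ℝ))
    (C : G.EdgeLabeling EdgeColor) :
    ∃ R B : G.Subgraph,
      IsConnectedMatching C EdgeColor.red R ∧
      IsConnectedMatching C EdgeColor.blue B ∧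
      Disjoint R.verts B.verts ∧
      (R ⊔ B).IsPerfectMatching := by
  subst hn
  rcases isEmpty_or_nonempty V with hV | hV
  · refine ⟨⊥, ⊥, ⟨?_, ?_, ?_⟩, ⟨?_, ?_, ?_⟩, by simp, ?_, ?_⟩ <;> intro v <;> exact hV.elim v
  have hdeg' : 3 * Fintype.card V ≤ 4 * G.minDegree := by
    have : (3 * (Fintype.card V : ℝ)) ≤ 4 * (G.minDegree : ℝ) := by linarith
    exact_mod_cast this
  have hcol : ∀ u v, G.Adj u v →
      (C.labelGraph .red).Adj u v ∨ (C.labelGraph .blue).Adj u v := by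
    intro u v h
    simp only [SimpleGraph.EdgeLabeling.labelGraph_adj]
    cases hc : C ⟨s(u, v), h⟩
    · exact Or.inl ⟨h, hc⟩
    · exact Or.inr ⟨h, hc⟩
  have hexcl : ∀ u v, (C.labelGraph .red).Adj u v → ¬ (C.labelGraph .blue).Adj u v := by
    intro u v hr hb
    simp only [SimpleGraph.EdgeLabeling.labelGraph_adj] at hr hb
    obtain ⟨_, h1⟩ := hr
    obtain ⟨_, h2⟩ := hb
    exact EdgeColor.noConfusion (h1.symm.trans h2)
  obtain ⟨r, b, M, hM, hspan⟩ := exists_twoComponentGraph_isPerfectMatching heven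
    (four_mul_card_add_four_le_of_not_adj hdeg') hcol
  have hR := isConnectedMatching_colorPart C hM .red r (by
    intro u v h hr
    exact (M.adj_sub h).elim (fun h' => h'.2) (fun h' => absurd h'.1 (hexcl u v hr)))
  have hB := isConnectedMatching_colorPart C hM .blue b (by
    intro u v h hb
    exact (M.adj_sub h).elim (fun h' => absurd hb (hexcl u v h'.1)) (fun h' => h'.2))
  have hdisj : Disjoint (colorPart C M .red).verts (colorPart C M .blue).verts := by
    rw [Set.disjoint_left]
    rintro v ⟨w, hw, hr⟩ ⟨w', hw', hb⟩
    rw [hM.eq_of_adj_left hw' hw] at hb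
    exact hexcl v w hr hb
  refine ⟨_, _, hR, hB, hdisj, ?_, ?_⟩
  · refine hR.1.sup hB.1 ?_
    rwa [hR.1.support_eq_verts, hB.1.support_eq_verts]
  · intro v
    obtain ⟨w, hw, -⟩ := hM (hspan v)
    rw [SimpleGraph.Subgraph.verts_sup]
    exact (M.adj_sub hw).imp (fun h => ⟨w, hw, h.1⟩) (fun h => ⟨w, hw, h.1⟩)
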